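/- Let $\Omega\subset\mathbb{R}^n$ be a bounded open set. For $f\in L^1(\mathbb{R}^n)$ let $$\|f\|_{\rm TV}=\sup\Big\{\int_{\mathbb{R}^n} f\,\nabla\cdot h\,dx : h\in C^1_c(\mathbb{R}^n,\mathbb{R}^n),\ |h(x)|\le 1 \text{ for all } x\Big\}\in[0,\infty],$$ and let $X$ be the space of all (classes of) real functions $f\in L^1(\mathbb{R}^n)$ with $\|f\|_{\rm TV}<\infty$ and support in $\overline\Omega$. A Caccioppoli set is a Borel set whose characteristic function has finite variation in every bounded open set. Let $T:X\to Y$ be a linear operator into a real Hilbert space $Y$, let $G$ be a random vector in $Y$, and let $\lambda\ge 0$. For $f\in X$ put $$\sigma(f)=\operatorname{Var}[\langle Tf,G\rangle]^{1/2},\qquad s_\lambda(f)=\frac{\lambda\|f\|_{\rm TV}}{\sigma(f)},$$ where $s_\lambda(f)=+\infty$ if $\sigma(f)=0$, and $\sigma(f)=+\infty$ if $\langle Tf,G\rangle$ is not square integrable. Suppose that there is a constant $C$ such that $\sigma(f)\le C\|f\|_{\rm TV}$ and $\sigma(f)\le C\|f\|_{L^\infty}$ for all $f\in X$. Let $s_0>0$.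 (a) If $\partial\Omega$ has Lebesgue measure zero and $s_\lambda(f)\ge s_0$ for every $f\in X$ which is the characteristic function of a Caccioppoli set $E\subset\Omega$, then $s_\lambda(f)\ge s_0$ for every $f\in X$. (b) For every bounded open $\Omega$, with no condition on its boundary, if $s_\lambda(f)\ge s_0$ for every $f\in X$ which is the characteristic function of a Caccioppoli set $E\subset\overline\Omega$, then $s_\lambda(f)\ge s_0$ for every $f\in X$. -/

import Mathlib

open MeasureTheory ProbabilityTheory Set
open scoped ENNReal NNReal

noncomputable section

/-- The Euclidean space `ℝⁿ`. -/
abbrev RSpace (n : ℕ) : Type := EuclideanSpace ℝ (Fin n)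

/-- The divergence `∑ᵢ ∂ᵢ hᵢ` of a vector field on `ℝⁿ`. -/
def divergence {n : ℕ} (h : RSpace n → RSpace n) (x : RSpace n) : ℝ :=
  ∑ i : Fin n, (fderiv ℝ h x (EuclideanSpace.single i 1)) i

/-- The admissible fields: `C¹` with compact support contained in `U`, and `|h| ≤ 1` pointwise. -/
structure IsTestField {n : ℕ} (U : Set (RSpace n)) (h : RSpace n → RSpace n) : Prop where
  contDiff : ContDiff ℝ 1 h
  hasCompactSupport : HasCompactSupport h
  tsupport_subset : tsupport h ⊆ U
  norm_le_one : ∀ x, ‖h x‖ ≤ 1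

/-- The variation of `f` in the open set `U`, with values in `[0, ∞]`:
the supremum of `∫ f div h` over the admissible fields `h`. (The field `h = 0` is admissible, so
that truncating the integrals at `0` does not change the supremum.) -/
def variationOn {n : ℕ} (f : RSpace n → ℝ) (U : Set (RSpace n)) : ℝ≥0∞ :=
  ⨆ (h : RSpace n → RSpace n) (_ : IsTestField U h),
    ENNReal.ofReal (∫ x, f x * divergence h x)

/-- The total variation `‖f‖_TV` of `f` on `ℝⁿ`. -/
def totalVar {n : ℕ} (f : RSpace n → ℝ) : ℝ≥0∞ := variationOn f univ

/-- Caccioppoli sets: Borel sets of finite perimeter in every bounded open set. -/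
def IsCaccioppoli {n : ℕ} (E : Set (RSpace n)) : Prop :=
  MeasurableSet E ∧ ∀ U : Set (RSpace n), IsOpen U → Bornology.IsBounded U →
    variationOn (E.indicator fun _ => (1 : ℝ)) U < ∞

theorem integrable_mul_divergence {n : ℕ} {U : Set (RSpace n)} {h : RSpace n → RSpace n}
    (hh : IsTestField U h) {f : RSpace n → ℝ} (hf : Integrable f) :
    Integrable fun x => f x * divergence h x := by
  have hc : Continuous (fderiv ℝ h) := hh.contDiff.continuous_fderiv (by norm_num)
  have hd : Continuous (divergence h) := by
    unfold divergence
    fun_prop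
  have hcs : HasCompactSupport (divergence h) := by
    refine (hh.hasCompactSupport.fderiv (𝕜 := ℝ)).mono ?_
    intro x hx hx0
    apply hx
    simp [divergence, hx0]
  obtain ⟨K, hK⟩ := hcs.exists_bound_of_continuous hd
  exact hf.mul_bdd hd.aestronglyMeasurable (Filter.Eventually.of_forall hK)

theorem totalVar_congr {n : ℕ} {f g : RSpace n → ℝ} (hfg : f =ᵐ[volume] g) :
    totalVar f = totalVar g := by
  unfold totalVar variationOn
  refine iSup_congr fun h => iSup_congr fun _ => ?_
  congr 1
  refine integral_congr_ae ?_
  filter_upwards [hfg] with x hx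
  rw [hx]

theorem totalVar_add_le {n : ℕ} {f g : RSpace n → ℝ} (hf : Integrable f) (hg : Integrable g) :
    totalVar (f + g) ≤ totalVar f + totalVar g := by
  refine iSup₂_le fun h hh => ?_
  have e : ∫ x, (f + g) x * divergence h x
      = (∫ x, f x * divergence h x) + ∫ x, g x * divergence h x := by
    rw [← integral_add (integrable_mul_divergence hh hf) (integrable_mul_divergence hh hg)]
    simp [add_mul]
  rw [e]
  refine ENNReal.ofReal_add_le.trans (add_le_add ?_ ?_)
  · exact le_iSup₂ (f := fun (h : RSpace n → RSpace n) (_ : IsTestField univ h) =>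
      ENNReal.ofReal (∫ x, f x * divergence h x)) h hh
  · exact le_iSup₂ (f := fun (h : RSpace n → RSpace n) (_ : IsTestField univ h) =>
      ENNReal.ofReal (∫ x, g x * divergence h x)) h hh

theorem divergence_neg {n : ℕ} (h : RSpace n → RSpace n) (x : RSpace n) :
    divergence (-h) x = -divergence h x := by
  simp [divergence, fderiv_neg]

theorem IsTestField.neg {n : ℕ} {U : Set (RSpace n)} {h : RSpace n → RSpace n}
    (hh : IsTestField U h) : IsTestField U (-h) where
  contDiff := hh.contDiff.neg
  hasCompactSupport := hh.hasCompactSupport.neg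
  tsupport_subset := by
    have e : tsupport (-h) = tsupport h := by simp [tsupport, Function.support_neg]
    rw [e]
    exact hh.tsupport_subset
  norm_le_one := fun x => by simpa using hh.norm_le_one x

theorem totalVar_smul_le {n : ℕ} (c : ℝ) (f : RSpace n → ℝ) :
    totalVar (c • f) ≤ ENNReal.ofReal |c| * totalVar f := by
  refine iSup₂_le fun h hh => ?_
  have key : ∀ k : RSpace n → RSpace n, IsTestField univ k →
      ENNReal.ofReal (∫ x, f x * divergence k x) ≤ totalVar f := fun k hk =>
    le_iSup₂ (f := fun (h : RSpace n → RSpace n) (_ : IsTestField univ h) =>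
      ENNReal.ofReal (∫ x, f x * divergence h x)) k hk
  have e : ∫ x, (c • f) x * divergence h x = c * ∫ x, f x * divergence h x := by
    rw [← integral_const_mul]
    simp [mul_assoc]
  rw [e]
  rcases le_total 0 c with hc | hc
  · rw [ENNReal.ofReal_mul hc, abs_of_nonneg hc]
    gcongr
    exact key h hh
  · have e2 : c * ∫ x, f x * divergence h x = (-c) * ∫ x, f x * divergence (-h) x := by
      simp [divergence_neg, integral_neg]
    rw [e2, ENNReal.ofReal_mul (by linarith), abs_of_nonpos hc]
    gcongr
    exact key _ hh.neg

/-- The space of functions of bounded variation on `ℝⁿ` (classes in `L¹` of finite total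
variation) with support in the closure of `Ω`, that is, vanishing almost everywhere outside it. -/
def bvSpace {n : ℕ} (Ω : Set (RSpace n)) : Submodule ℝ (Lp ℝ 1 (volume : Measure (RSpace n))) where
  carrier := {f | totalVar f < ∞ ∧ ∀ᵐ x, x ∉ closure Ω → f x = 0}
  zero_mem' := by
    refine ⟨?_, ?_⟩
    · rw [totalVar_congr (Lp.coeFn_zero ℝ 1 volume)]
      simp [totalVar, variationOn]
    · filter_upwards [Lp.coeFn_zero ℝ 1 (volume : Measure (RSpace n))] with x hx _
      simp
  add_mem' := by
    rintro f g ⟨hf, hf0⟩ ⟨hg, hg0⟩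
    refine ⟨?_, ?_⟩
    · rw [totalVar_congr (Lp.coeFn_add f g)]
      exact (totalVar_add_le (L1.integrable_coeFn f) (L1.integrable_coeFn g)).trans_lt
        (ENNReal.add_lt_top.2 ⟨hf, hg⟩)
    · filter_upwards [Lp.coeFn_add f g, hf0, hg0] with x hx h1 h2 hx'
      rw [hx, Pi.add_apply, h1 hx', h2 hx', add_zero]
  smul_mem' := by
    rintro c f ⟨hf, hf0⟩
    refine ⟨?_, ?_⟩
    · rw [totalVar_congr (Lp.coeFn_smul c f)]
      exact (totalVar_smul_le c f).trans_lt (ENNReal.mul_lt_top ENNReal.ofReal_lt_top hf)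
    · filter_upwards [Lp.coeFn_smul c f, hf0] with x hx h1 hx'
      rw [hx, Pi.smul_apply, h1 hx', smul_zero]

/-- `f` is (the class of) the characteristic function of the set `E`. -/
def IsCharFun {n : ℕ} {Ω : Set (RSpace n)} (f : bvSpace Ω) (E : Set (RSpace n)) : Prop :=
  (f : RSpace n → ℝ) =ᵐ[volume] E.indicator fun _ => (1 : ℝ)

variable {n : ℕ} {Ω : Set (RSpace n)} {Y : Type*} [NormedAddCommGroup Y] [InnerProductSpace ℝ Y]
  {S : Type*} [MeasurableSpace S]

/-- The standard deviation `σ(f) = Var[⟨T f, G⟩]^{1/2}`, with values in `[0, ∞]`; it is `∞` exactly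
when the random variable `⟨T f, G⟩` is not square integrable. -/
def noiseSD (T : bvSpace Ω →ₗ[ℝ] Y) (G : S → Y) (P : Measure S) (f : bvSpace Ω) : ℝ≥0∞ :=
  evariance (fun ω => inner ℝ (T f) (G ω)) P ^ (1 / 2 : ℝ)

open Classical in
/-- The quotient `s_λ(f) = λ ‖f‖_TV / σ(f)`, with the convention that it is `∞` if `σ(f) = 0`
(also for `f = 0`, where the quotient reads `0 / 0`). -/
def regRatio (T : bvSpace Ω →ₗ[ℝ] Y) (G : S → Y) (P : Measure S) (lam : ℝ≥0) (f : bvSpace Ω) :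
    ℝ≥0∞ :=
  if noiseSD T G P f = 0 then ∞ else lam * totalVar (f : RSpace n → ℝ) / noiseSD T G P f

end

section

variable {n : ℕ} {Ω : Set (RSpace n)} {Y : Type*} [NormedAddCommGroup Y] [InnerProductSpace ℝ Y]
  {S : Type*} [MeasurableSpace S]

open Filter Topology ContinuousLinearMap
open scoped Convolution

/-! The ratio bound says `s₀ σ(f) ≤ λ ‖f‖_TV`, and `σ` is a seminorm, being the `L²` norm of a
centred variable that depends linearly on `f`. So the claim concerns a seminorm `N` dominated by the
variation and by the sup norm: if `N ≤ K · perimeter` on characteristic functions, then `N ≤ K ·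
TV`. The heuristic is the layer cake formula `u = ∫ χ_{u > t} dt` together with the coarea formula.
Only a discrete inequality form of the latter is needed.

The basic inequality is `TV((f - c)⁺) + TV(min(f, c)) ≤ TV(f)`
(`totalVar_posPart_add_totalVar_min_le`). For smooth `g`, two test fields are glued into one by a
weight depending on `g`; mollification gives the general case.

Hence `V(a) = TV((u - a)⁺)` is nonincreasing on `a ≥ 0`, and it tends to `0` at infinity. By lower
semicontinuity `{u > s}` has perimeter at most `-V'(s)` wherever `V` is differentiable, so every
layer `[iδ, (i+1)δ]` contains a level `sᵢ` with `δ · Per{u > sᵢ} ≤ V(iδ) - V((i+1)δ)`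
(`exists_superlevel`).

For `u ≥ 0` the step function `∑ δ χ_{u > sᵢ}`, `i < m`, is within `δ` of `min(u, mδ)` in sup norm,
and the remainder `(u - mδ)⁺` has variation `V(mδ)`. The perimeter bounds telescope, so `N(u) ≤ C
V(mδ) + C δ + K TV(u)`; let `δ → 0` and `mδ → ∞`. A signed function is split at level `0`. -/

theorem continuous_divergence {h : RSpace n → RSpace n} (hh : ContDiff ℝ 1 h) :
    Continuous (divergence h) := by
  have hc : Continuous (fderiv ℝ h) := hh.continuous_fderiv (by norm_num)
  unfold divergence
  fun_prop

theorem hasCompactSupport_divergence {h : RSpace n → RSpace n} (hs : HasCompactSupport h) :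
    HasCompactSupport (divergence h) := by
  refine (hs.fderiv (𝕜 := ℝ)).mono ?_
  intro x hx hx0
  apply hx
  simp [divergence, hx0]

/-- The divergence theorem for compactly supported fields. -/
theorem integral_divergence_eq_zero {h : RSpace n → RSpace n} (hh : ContDiff ℝ 1 h)
    (hs : HasCompactSupport h) : ∫ x, divergence h x = 0 := by
  have hc : Continuous (fderiv ℝ h) := hh.continuous_fderiv (by norm_num)
  have hd : Differentiable ℝ h := hh.differentiable (by norm_num)
  have hi : ∀ i : Fin n, Integrable fun x => (fderiv ℝ h x (EuclideanSpace.single i 1)) i := by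
    intro i
    refine Continuous.integrable_of_hasCompactSupport (by fun_prop) ?_
    refine (hs.fderiv (𝕜 := ℝ)).mono fun x hx hx0 => hx ?_
    simp [hx0]
  unfold divergence
  rw [integral_finsetSum _ fun i _ => hi i]
  refine Finset.sum_eq_zero fun i _ => ?_
  have hcomp : ∀ x, HasFDerivAt (fun y => h y i)
      ((EuclideanSpace.proj i : RSpace n →L[ℝ] ℝ).comp (fderiv ℝ h x)) x := fun x =>
    (EuclideanSpace.proj i : RSpace n →L[ℝ] ℝ).hasFDerivAt.comp x (hd x).hasFDerivAt
  have hci : Continuous fun y => h y i := by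
    have := hh.continuous
    fun_prop
  have hsi : HasCompactSupport fun y => h y i :=
    hs.mono fun x hx hx0 => hx (by simp [hx0])
  -- Integration by parts against the constant function `1`, one coordinate at a time.
  have := integral_bilinear_hasFDerivAt_right_eq_neg_left_of_integrable
    (μ := (volume : Measure (RSpace n))) (B := ContinuousLinearMap.mul ℝ ℝ)
    (f := fun _ => (1 : ℝ)) (f' := fun _ => 0) (g := fun y => h y i)
    (g' := fun x => (EuclideanSpace.proj i : RSpace n →L[ℝ] ℝ).comp (fderiv ℝ h x))
    (v := EuclideanSpace.single i 1) (by simp) (by simpa using hi i)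
    (by simpa using hci.integrable_of_hasCompactSupport hsi)
    (fun x _ => hasFDerivAt_const _ _) (fun x _ => hcomp x)
  simpa using this

theorem divergence_smul {g : RSpace n → ℝ} {h : RSpace n → RSpace n} {x : RSpace n}
    (hg : DifferentiableAt ℝ g x) (hh : DifferentiableAt ℝ h x) :
    divergence (fun y => g y • h y) x = g x * divergence h x + fderiv ℝ g x (h x) := by
  have e : h x = ∑ i, h x i • EuclideanSpace.single i (1 : ℝ) := by
    simpa using ((EuclideanSpace.basisFun (Fin n) ℝ).sum_repr (h x)).symm
  have e2 : fderiv ℝ g x (h x) = ∑ i, h x i * fderiv ℝ g x (EuclideanSpace.single i 1) := by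
    conv_lhs => rw [e]
    simp [map_sum]
  unfold divergence
  rw [e2, Finset.mul_sum, ← Finset.sum_add_distrib]
  refine Finset.sum_congr rfl fun i _ => ?_
  rw [fderiv_fun_smul hg hh]
  simp [mul_comm]

/-- The divergence is the trace of the derivative. -/
noncomputable def traceCLM (n : ℕ) : (RSpace n →L[ℝ] RSpace n) →L[ℝ] ℝ :=
  ∑ i : Fin n, (EuclideanSpace.proj i : RSpace n →L[ℝ] ℝ).comp
    (ContinuousLinearMap.apply ℝ (RSpace n) (EuclideanSpace.single i 1))

theorem divergence_eq_traceCLM (h : RSpace n → RSpace n) (x : RSpace n) :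
    divergence h x = traceCLM n (fderiv ℝ h x) := by
  simp [divergence, traceCLM]

/-! ### Mollification and the total variation. -/

variable (φ : ContDiffBump (0 : RSpace n))

/-- The derivative of the convolution can be put on `h`, and the trace, a continuous linear
functional, commutes with the integral. -/
theorem divergence_convolution {h : RSpace n → RSpace n} (hh : ContDiff ℝ 1 h)
    (hs : HasCompactSupport h) (x : RSpace n) :
    divergence (φ.normed volume ⋆[lsmul ℝ ℝ, volume] h) x
      = (φ.normed volume ⋆[lsmul ℝ ℝ, volume] divergence h) x := by
  have hl : LocallyIntegrable (φ.normed (volume : Measure (RSpace n))) :=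
    φ.integrable_normed.locallyIntegrable
  have hc : Continuous (fderiv ℝ h) := hh.continuous_fderiv (by norm_num)
  rw [divergence_eq_traceCLM,
    (hs.hasFDerivAt_convolution_right (lsmul ℝ ℝ) hl hh x).fderiv, convolution_def,
    convolution_def]
  have hex := (hs.fderiv (𝕜 := ℝ)).convolutionExists_right
    ((lsmul ℝ ℝ).precompR (RSpace n) : ℝ →L[ℝ] _) hl hc x
  rw [← ContinuousLinearMap.integral_comp_comm _ hex]
  refine integral_congr_ae (Eventually.of_forall fun t => ?_)
  have : ((lsmul ℝ ℝ).precompR (RSpace n) : ℝ →L[ℝ] _) (φ.normed volume t) (fderiv ℝ h (x - t))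
      = φ.normed volume t • fderiv ℝ h (x - t) := by
    ext v
    simp
  simp only [this, map_smul, divergence_eq_traceCLM, lsmul_apply]

/-- The kernel is nonnegative with integral `1`, so averaging keeps values in the unit ball. -/
theorem IsTestField.convolution {h : RSpace n → RSpace n} (hh : IsTestField univ h) :
    IsTestField univ (φ.normed volume ⋆[lsmul ℝ ℝ, volume] h) where
  contDiff := hh.hasCompactSupport.contDiff_convolution_right (n := 1) _
    φ.integrable_normed.locallyIntegrable hh.contDiff
  hasCompactSupport := φ.hasCompactSupport_normed.convolution _ hh.hasCompactSupport
  tsupport_subset := subset_univ _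
  norm_le_one := fun x => by
    rw [convolution_def]
    refine (norm_integral_le_integral_norm _).trans ?_
    rw [← φ.integral_normed (μ := volume)]
    refine integral_mono_of_nonneg (Eventually.of_forall fun t => norm_nonneg _)
      φ.integrable_normed (Eventually.of_forall fun t => ?_)
    simp only [lsmul_apply, norm_smul, Real.norm_of_nonneg (φ.nonneg_normed t)]
    exact mul_le_of_le_one_right (φ.nonneg_normed t) (hh.norm_le_one _)

/-- Convolution with an even kernel is symmetric. -/
theorem integral_convolution_mul {f d : RSpace n → ℝ} (hf : Integrable f) (hd : Continuous d)
    (hds : HasCompactSupport d) :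
    ∫ x, (φ.normed volume ⋆[lsmul ℝ ℝ, volume] f) x * d x
      = ∫ x, f x * (φ.normed volume ⋆[lsmul ℝ ℝ, volume] d) x := by
  obtain ⟨K, hK⟩ := hds.exists_bound_of_continuous hd
  have hint : Integrable (fun p : RSpace n × RSpace n =>
      φ.normed volume p.2 * f (p.1 - p.2) * d p.1) (volume.prod volume) := by
    refine Integrable.mul_bdd (c := K) ?_
      (hd.comp continuous_fst).aestronglyMeasurable (Eventually.of_forall fun p => hK _)
    simpa using (φ.integrable_normed (μ := volume)).convolution_integrand (lsmul ℝ ℝ) hf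
  calc ∫ x, (φ.normed volume ⋆[lsmul ℝ ℝ, volume] f) x * d x
      = ∫ x, ∫ t, φ.normed volume t * f (x - t) * d x := by
        refine integral_congr_ae (Eventually.of_forall fun x => ?_)
        simp only [convolution_def, lsmul_apply, smul_eq_mul]
        rw [← integral_mul_const]
    _ = ∫ t, ∫ x, φ.normed volume t * f (x - t) * d x := integral_integral_swap hint
    _ = ∫ t, ∫ x, φ.normed volume t * f x * d (x + t) := by
        refine integral_congr_ae (Eventually.of_forall fun t => ?_)
        simp only
        rw [← integral_add_right_eq_self _ t]
        simp
    -- Evenness of the kernel enters here, through `t ↦ -t`.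
    _ = ∫ t, ∫ x, φ.normed volume t * f x * d (x - t) := by
        rw [← integral_neg_eq_self]
        simp [φ.normed_neg, sub_eq_add_neg]
    _ = ∫ x, ∫ t, φ.normed volume t * f x * d (x - t) := by
        refine integral_integral_swap ?_
        refine Integrable.mul_bdd (c := K) ?_ ?_ (Eventually.of_forall fun p => hK _)
        · exact (φ.integrable_normed (μ := volume)).mul_prod hf
        · exact (hd.comp (continuous_snd.sub continuous_fst)).aestronglyMeasurable
    _ = ∫ x, f x * (φ.normed volume ⋆[lsmul ℝ ℝ, volume] d) x := by
        refine integral_congr_ae (Eventually.of_forall fun x => ?_)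
        simp only [convolution_def, lsmul_apply, smul_eq_mul]
        rw [← integral_const_mul]
        congr 1 with t
        ring

theorem ofReal_integral_le_totalVar {f : RSpace n → ℝ} {h : RSpace n → RSpace n}
    (hh : IsTestField univ h) : ENNReal.ofReal (∫ x, f x * divergence h x) ≤ totalVar f :=
  le_iSup₂ (f := fun (h : RSpace n → RSpace n) (_ : IsTestField univ h) =>
    ENNReal.ofReal (∫ x, f x * divergence h x)) h hh

/-- By symmetry the mollifier moves from `f` to the test field, which stays admissible. -/
theorem totalVar_convolution_le {f : RSpace n → ℝ} (hf : Integrable f) :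
    totalVar (φ.normed volume ⋆[lsmul ℝ ℝ, volume] f) ≤ totalVar f := by
  refine iSup₂_le fun h hh => ?_
  rw [integral_convolution_mul φ hf (continuous_divergence hh.contDiff)
    (hasCompactSupport_divergence hh.hasCompactSupport)]
  simp_rw [← divergence_convolution φ hh.contDiff hh.hasCompactSupport]
  exact ofReal_integral_le_totalVar (hh.convolution φ)

theorem integral_abs_convolution_le {f : RSpace n → ℝ} (hf : Integrable f) :
    ∫ x, |(φ.normed volume ⋆[lsmul ℝ ℝ, volume] f) x| ≤ ∫ x, |f x| := by
  have h1 := φ.integrable_normed (μ := (volume : Measure (RSpace n)))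
  have e : ∫ x, (φ.normed volume ⋆[lsmul ℝ ℝ, volume] fun y => |f y|) x = ∫ x, |f x| := by
    rw [integral_convolution (lsmul ℝ ℝ) h1 hf.abs, φ.integral_normed]
    simp
  rw [← e]
  refine integral_mono_of_nonneg (Eventually.of_forall fun _ => abs_nonneg _)
    (h1.integrable_convolution _ hf.abs) (Eventually.of_forall fun x => ?_)
  simp only [convolution_def, lsmul_apply, smul_eq_mul]
  refine (abs_integral_le_integral_abs).trans_eq ?_
  simp [abs_mul, abs_of_nonneg (φ.nonneg_normed _)]

/-- Mollification approximates in `L¹`. -/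
theorem exists_integral_abs_convolution_sub_le {f : RSpace n → ℝ} (hf : Integrable f) {ε : ℝ}
    (hε : 0 < ε) : ∃ φ : ContDiffBump (0 : RSpace n),
      ∫ x, |(φ.normed volume ⋆[lsmul ℝ ℝ, volume] f) x - f x| ≤ ε := by
  obtain ⟨g, hgs, hfg, hgc, hgi⟩ :=
    hf.exists_hasCompactSupport_integral_sub_le (ε := ε / 3) (by positivity)
  -- With mollification radius at most `1`, the error for `g` vanishes off `K`. On `K` it is at most
  -- `η`, chosen so that `η · vol K ≤ ε / 3`; the `+ 1` keeps the denominator positive.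
  set K := Metric.cthickening 1 (tsupport g) with hKdef
  have hK : IsCompact K := hgs.isCompact.cthickening
  set η := ε / 3 / (volume.real K + 1) with hη
  have hη0 : 0 < η := by positivity
  obtain ⟨r, hr, hrg⟩ := Metric.uniformContinuous_iff.1
    (hgs.uniformContinuous_of_continuous hgc) η hη0
  have hm : 0 < min r 1 := by positivity
  let φ : ContDiffBump (0 : RSpace n) := ⟨min r 1 / 2, min r 1, by positivity, by linarith⟩
  have hφ : φ.rOut = min r 1 := rfl
  refine ⟨φ, ?_⟩
  have h1 := φ.integrable_normed (μ := (volume : Measure (RSpace n)))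
  have hci : ∀ {u : RSpace n → ℝ}, Integrable u →
      Integrable (φ.normed volume ⋆[lsmul ℝ ℝ, volume] u) := fun hu =>
    h1.integrable_convolution _ hu
  have hgd : ∀ x, |(φ.normed volume ⋆[lsmul ℝ ℝ, volume] g) x - g x| ≤ K.indicator (fun _ => η) x := by
    intro x
    by_cases hx : x ∈ K
    · rw [indicator_of_mem hx, ← Real.dist_eq]
      refine φ.dist_normed_convolution_le hgc.aestronglyMeasurable fun y hy => ?_
      refine (hrg ?_).le
      exact (Metric.mem_ball.1 hy).trans_le (hφ ▸ min_le_left _ _)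
    · have hz : ∀ y ∈ Metric.closedBall x 1, g y = 0 := by
        intro y hy
        by_contra h0
        refine hx (Metric.mem_cthickening_of_dist_le x y 1 _ (subset_tsupport g h0) ?_)
        rw [dist_comm]
        exact hy
      rw [indicator_of_notMem hx, φ.normed_convolution_eq_right]
      · simp
      · intro y hy
        rw [hz x (by simp), hz y]
        exact (Metric.mem_ball.1 hy).le.trans (hφ ▸ min_le_right _ _)
  have hI : ∫ x, |(φ.normed volume ⋆[lsmul ℝ ℝ, volume] g) x - g x| ≤ ε / 3 := by
    refine (integral_mono_of_nonneg (Eventually.of_forall fun _ => abs_nonneg _)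
      ((integrable_indicator_iff hK.measurableSet).2
        (integrableOn_const hK.measure_lt_top.ne)) (Eventually.of_forall hgd)).trans ?_
    rw [integral_indicator hK.measurableSet, setIntegral_const, smul_eq_mul, hη,
      mul_div_assoc', div_le_iff₀ (by positivity)]
    nlinarith
  have hJ := integral_abs_convolution_le φ (hf.sub hgi)
  simp only [Real.norm_eq_abs] at hfg
  have hadd : ∀ x, |(φ.normed volume ⋆[lsmul ℝ ℝ, volume] f) x - f x|
      ≤ |(φ.normed volume ⋆[lsmul ℝ ℝ, volume] f) x - (φ.normed volume ⋆[lsmul ℝ ℝ, volume] g) x|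
        + |(φ.normed volume ⋆[lsmul ℝ ℝ, volume] g) x - g x| + |f x - g x| := by
    intro x
    rw [abs_sub_comm (f x)]
    refine (le_trans ?_ (add_le_add_left (abs_add_le _ _) _))
    refine (le_trans ?_ (abs_add_le _ _))
    ring_nf
    rfl
  have hsub : ∫ x, |(φ.normed volume ⋆[lsmul ℝ ℝ, volume] f) x
      - (φ.normed volume ⋆[lsmul ℝ ℝ, volume] g) x| ≤ ∫ x, |f x - g x| := by
    refine le_trans (le_of_eq ?_) hJ
    refine integral_congr_ae ?_
    filter_upwards [h1.ae_convolution_exists (lsmul ℝ ℝ) hf,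
      h1.ae_convolution_exists (lsmul ℝ ℝ) hgi] with x hx hy
    simp only [convolution_def, Pi.sub_apply, map_sub]
    rw [integral_sub hx hy]
  have i1 := ((hci hf).sub (hci hgi)).abs
  have i2 := ((hci hgi).sub hgi).abs
  have i3 := (hf.sub hgi).abs
  refine (integral_mono ((hci hf).sub hf).abs ((i1.add i2).add i3) hadd).trans ?_
  have e : ∫ x, (((fun a => |((φ.normed volume ⋆[lsmul ℝ ℝ, volume] f)
      - (φ.normed volume ⋆[lsmul ℝ ℝ, volume] g)) a|)
      + fun a => |((φ.normed volume ⋆[lsmul ℝ ℝ, volume] g) - g) a|)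
      + fun a => |(f - g) a|) x = _ := integral_add (i1.add i2) i3
  have e' : ∫ x, ((fun a => |((φ.normed volume ⋆[lsmul ℝ ℝ, volume] f)
      - (φ.normed volume ⋆[lsmul ℝ ℝ, volume] g)) a|)
      + fun a => |((φ.normed volume ⋆[lsmul ℝ ℝ, volume] g) - g) a|) x = _ := integral_add i1 i2
  simp only [Pi.add_apply, Pi.sub_apply] at e e' ⊢
  linarith

/-! ### Splitting the total variation at a level. -/

/-- A smooth approximation of the positive part. -/
noncomputable def smoothPos (δ y : ℝ) : ℝ := (y + √(y ^ 2 + δ ^ 2)) / 2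

/-- The derivative of `smoothPos δ`. -/
noncomputable def smoothStep (δ y : ℝ) : ℝ := (1 + y / √(y ^ 2 + δ ^ 2)) / 2

theorem abs_smoothPos_sub_le {δ : ℝ} (hδ : 0 < δ) (y : ℝ) : |smoothPos δ y - max y 0| ≤ δ := by
  have h1 : |y| ≤ √(y ^ 2 + δ ^ 2) := Real.abs_le_sqrt (by nlinarith [sq_nonneg δ])
  have h2 : √(y ^ 2 + δ ^ 2) ≤ |y| + δ := by
    rw [Real.sqrt_le_left (by positivity), ← sq_abs y]
    nlinarith [abs_nonneg y]
  unfold smoothPos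
  rcases le_total 0 y with h | h
  · rw [max_eq_left h, abs_le]
    rw [abs_of_nonneg h] at h1 h2
    constructor <;> linarith
  · rw [max_eq_right h, abs_le]
    rw [abs_of_nonpos h] at h1 h2
    constructor <;> linarith

theorem hasDerivAt_smoothPos {δ : ℝ} (hδ : 0 < δ) (y : ℝ) :
    HasDerivAt (smoothPos δ) (smoothStep δ y) y := by
  have h0 : y ^ 2 + δ ^ 2 ≠ 0 := by positivity
  have h1 : HasDerivAt (fun y : ℝ => y ^ 2 + δ ^ 2) (2 * y) y := by
    simpa using (hasDerivAt_pow 2 y).add_const (δ ^ 2)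
  have h2 := ((hasDerivAt_id y).add (h1.sqrt h0)).div_const 2
  refine h2.congr_deriv ?_
  have : √(y ^ 2 + δ ^ 2) ≠ 0 := by positivity
  unfold smoothStep
  field_simp

theorem smoothStep_mem {δ : ℝ} (hδ : 0 < δ) (y : ℝ) : smoothStep δ y ∈ Icc (0 : ℝ) 1 := by
  have h1 : |y| ≤ √(y ^ 2 + δ ^ 2) := Real.abs_le_sqrt (by nlinarith [sq_nonneg δ])
  have hp : 0 < √(y ^ 2 + δ ^ 2) := by positivity
  have h2 : |y / √(y ^ 2 + δ ^ 2)| ≤ 1 := by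
    rw [abs_div, abs_of_pos hp]
    exact div_le_one_of_le₀ h1 hp.le
  rw [abs_le] at h2
  unfold smoothStep
  constructor <;> linarith [h2.1, h2.2]

theorem contDiff_smoothPos {δ : ℝ} (hδ : 0 < δ) : ContDiff ℝ 1 (smoothPos δ) := by
  unfold smoothPos
  have : ∀ y : ℝ, y ^ 2 + δ ^ 2 ≠ 0 := fun y => by positivity
  exact (contDiff_id.add (((contDiff_id.pow 2).add contDiff_const).sqrt this)).div_const 2

theorem contDiff_smoothStep {δ : ℝ} (hδ : 0 < δ) : ContDiff ℝ 1 (smoothStep δ) := by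
  unfold smoothStep
  have h : ∀ y : ℝ, y ^ 2 + δ ^ 2 ≠ 0 := fun y => by positivity
  have h' : ∀ y : ℝ, √(y ^ 2 + δ ^ 2) ≠ 0 := fun y => by positivity
  exact (contDiff_const.add
    (contDiff_id.div (((contDiff_id.pow 2).add contDiff_const).sqrt h) h')).div_const 2

theorem IsTestField.convexComb {U : Set (RSpace n)} {h₁ h₂ : RSpace n → RSpace n}
    (hh₁ : IsTestField U h₁) (hh₂ : IsTestField U h₂) {w : RSpace n → ℝ} (hw : ContDiff ℝ 1 w)
    (hw01 : ∀ x, w x ∈ Icc (0 : ℝ) 1) :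
    IsTestField U fun x => w x • h₁ x + (1 - w x) • h₂ x where
  contDiff := (hw.smul hh₁.contDiff).add ((contDiff_const.sub hw).smul hh₂.contDiff)
  hasCompactSupport := (hh₁.hasCompactSupport.smul_left (f := w)).add
    (hh₂.hasCompactSupport.smul_left (f := fun x => 1 - w x))
  tsupport_subset := by
    refine (tsupport_add _ _).trans (union_subset ?_ ?_)
    · exact (tsupport_smul_subset_right w h₁).trans hh₁.tsupport_subset
    · exact (tsupport_smul_subset_right (fun x => 1 - w x) h₂).trans hh₂.tsupport_subset
  norm_le_one := fun x => by
    obtain ⟨h0, h1⟩ := hw01 x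
    refine (norm_add_le _ _).trans ?_
    rw [norm_smul, norm_smul, Real.norm_of_nonneg h0, Real.norm_of_nonneg (by linarith)]
    nlinarith [hh₁.norm_le_one x, hh₂.norm_le_one x]

/-- Truncations such as `max (f - c) 0` with `c < 0` need not be integrable on the whole space; the
compact support of `d` compensates. -/
theorem integrable_mul_of_abs_le {f u d : RSpace n → ℝ} (hf : Integrable f) {K : ℝ}
    (hu : AEStronglyMeasurable u volume) (hK : ∀ x, |u x| ≤ |f x| + K) (hd : Continuous d)
    (hds : HasCompactSupport d) : Integrable fun x => u x * d x := by
  obtain ⟨M, hM⟩ := hds.exists_bound_of_continuous hd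
  have h1 : Integrable fun x => f x * d x :=
    hf.mul_bdd hd.aestronglyMeasurable (Eventually.of_forall hM)
  have h2 := (hd.integrable_of_hasCompactSupport hds (μ := volume)).abs.const_mul K
  refine (h1.abs.add h2).mono' (hu.mul hd.aestronglyMeasurable) (Eventually.of_forall fun x => ?_)
  simp only [Pi.add_apply, Real.norm_eq_abs, abs_mul]
  nlinarith [hK x, abs_nonneg (d x)]

/-- Testing `g` against `w h₁ + (1 - w) h₂`, with `w` the derivative of the smoothed truncation at
`g - c`, tests the upper part against `h₁` and the lower part against `h₂` simultaneously. -/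
theorem integral_smooth_split {δ : ℝ} (hδ : 0 < δ) {g : RSpace n → ℝ} (hg : ContDiff ℝ 1 g)
    (c : ℝ) {h₁ h₂ : RSpace n → RSpace n} (hh₁ : IsTestField univ h₁)
    (hh₂ : IsTestField univ h₂) :
    ENNReal.ofReal ((∫ x, smoothPos δ (g x - c) * divergence h₁ x)
      + ∫ x, (g x - smoothPos δ (g x - c)) * divergence h₂ x) ≤ totalVar g := by
  set p : RSpace n → ℝ := fun x => smoothPos δ (g x - c) with hp
  set w : RSpace n → ℝ := fun x => smoothStep δ (g x - c) with hw
  have hpc : ContDiff ℝ 1 p := (contDiff_smoothPos hδ).comp (hg.sub contDiff_const)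
  have hwc : ContDiff ℝ 1 w := (contDiff_smoothStep hδ).comp (hg.sub contDiff_const)
  set h : RSpace n → RSpace n := fun x => w x • h₁ x + (1 - w x) • h₂ x with hh
  have ht : IsTestField univ h := hh₁.convexComb hh₂ hwc fun x => smoothStep_mem hδ _
  have d1 : ∀ {E : Type} [NormedAddCommGroup E] [NormedSpace ℝ E] {u : RSpace n → E},
      ContDiff ℝ 1 u → ∀ x, DifferentiableAt ℝ u x :=
    fun hu x => (hu.differentiable (by norm_num)) x
  have hq : ContDiff ℝ 1 fun x => g x - p x := hg.sub hpc
  have hfd : ∀ x, fderiv ℝ p x = w x • fderiv ℝ g x := fun x => by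
    have := (hasDerivAt_smoothPos hδ (g x - c)).comp_hasFDerivAt x
      ((d1 hg x).hasFDerivAt.sub_const c)
    exact this.fderiv
  -- Since `∇p = w ∇g`, the gradient terms of the three product rules cancel, leaving only exact
  -- divergences, which integrate to zero.
  have key : ∀ x, g x * divergence h x = p x * divergence h₁ x + (g x - p x) * divergence h₂ x
      + (divergence (fun y => g y • h y) x - divergence (fun y => p y • h₁ y) x
        - divergence (fun y => (g y - p y) • h₂ y) x) := by
    intro x
    rw [divergence_smul (d1 hg x) (d1 ht.contDiff x), divergence_smul (d1 hpc x) (d1 hh₁.contDiff x),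
      divergence_smul (d1 hq x) (d1 hh₂.contDiff x), fderiv_fun_sub (d1 hg x) (d1 hpc x), hfd]
    simp only [hh, map_add, map_smul, smul_eq_mul, _root_.sub_apply,
      _root_.smul_apply]
    ring
  have hz : ∀ {u : RSpace n → ℝ} {k : RSpace n → RSpace n}, ContDiff ℝ 1 u → IsTestField univ k →
      Integrable (divergence fun y => u y • k y) ∧ ∫ x, divergence (fun y => u y • k y) x = 0 := by
    intro u k hu hk
    have hc := hu.smul hk.contDiff
    have hs := hk.hasCompactSupport.smul_left (f := u)
    exact ⟨(continuous_divergence hc).integrable_of_hasCompactSupport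
      (hasCompactSupport_divergence hs), integral_divergence_eq_zero hc hs⟩
  have hi : ∀ {u : RSpace n → ℝ} {k : RSpace n → RSpace n}, ContDiff ℝ 1 u → IsTestField univ k →
      Integrable fun x => u x * divergence k x := by
    intro u k hu hk
    exact (hu.continuous.mul (continuous_divergence hk.contDiff)).integrable_of_hasCompactSupport
      (hasCompactSupport_divergence hk.hasCompactSupport).mul_left
  have e : (∫ x, p x * divergence h₁ x) + ∫ x, (g x - p x) * divergence h₂ x
      = ∫ x, g x * divergence h x := by
    have j₁ : Integrable fun x => p x * divergence h₁ x + (g x - p x) * divergence h₂ x :=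
      (hi hpc hh₁).add (hi hq hh₂)
    have j₂ : Integrable fun x => divergence (fun y => g y • h y) x
        - divergence (fun y => p y • h₁ y) x := (hz hg ht).1.sub (hz hpc hh₁).1
    have j₃ : Integrable fun x => divergence (fun y => g y • h y) x
        - divergence (fun y => p y • h₁ y) x - divergence (fun y => (g y - p y) • h₂ y) x :=
      j₂.sub (hz hq hh₂).1
    simp_rw [key]
    rw [integral_add j₁ j₃, integral_add (hi hpc hh₁) (hi hq hh₂), integral_sub j₂ (hz hq hh₂).1,
      integral_sub (hz hg ht).1 (hz hpc hh₁).1, (hz hg ht).2, (hz hpc hh₁).2, (hz hq hh₂).2]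
    simp
  rw [e]
  exact ofReal_integral_le_totalVar ht

theorem integral_mul_le_add {u v e d : RSpace n → ℝ} {δ M : ℝ}
    (hud : Integrable fun x => u x * d x) (hvd : Integrable fun x => v x * d x)
    (he : Integrable e) (hd : Integrable d) (hM : ∀ x, |d x| ≤ M)
    (huv : ∀ x, |u x - v x| ≤ |e x| + δ) :
    ∫ x, u x * d x ≤ (∫ x, v x * d x) + (M * (∫ x, |e x|) + δ * ∫ x, |d x|) := by
  have j : Integrable fun x => M * |e x| + δ * |d x| :=
    (he.abs.const_mul M).add (hd.abs.const_mul δ)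
  rw [← integral_const_mul, ← integral_const_mul,
    ← integral_add (he.abs.const_mul M) (hd.abs.const_mul δ), ← integral_add hvd j]
  refine integral_mono hud (hvd.add j) fun x => ?_
  have h1 : (u x - v x) * d x ≤ |u x - v x| * |d x| := by
    rw [← abs_mul]
    exact le_abs_self _
  have h2 := mul_le_mul_of_nonneg_right (huv x) (abs_nonneg (d x))
  have h3 := mul_le_mul_of_nonneg_left (hM x) (abs_nonneg (e x))
  nlinarith

/-- Truncation is 1-Lipschitz, so the smooth case for a mollification of `f` passes to the limit.
One `ε` serves as both `L¹` error and smoothing parameter. -/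
theorem ofReal_integral_split_le {f : RSpace n → ℝ} (hf : Integrable f) (c : ℝ)
    {h₁ h₂ : RSpace n → RSpace n} (hh₁ : IsTestField univ h₁) (hh₂ : IsTestField univ h₂) :
    ENNReal.ofReal ((∫ x, max (f x - c) 0 * divergence h₁ x)
      + ∫ x, min (f x) c * divergence h₂ x) ≤ totalVar f := by
  rcases eq_or_ne (totalVar f) ∞ with htop | htop
  · rw [htop]
    exact le_top
  rw [ENNReal.ofReal_le_iff_le_toReal htop]
  have hc₁ := continuous_divergence hh₁.contDiff
  have hc₂ := continuous_divergence hh₂.contDiff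
  have hs₁ := hasCompactSupport_divergence hh₁.hasCompactSupport
  have hs₂ := hasCompactSupport_divergence hh₂.hasCompactSupport
  obtain ⟨M₁, hM₁⟩ := hs₁.exists_bound_of_continuous hc₁
  obtain ⟨M₂, hM₂⟩ := hs₂.exists_bound_of_continuous hc₂
  set I₁ := ∫ x, |divergence h₁ x|
  set I₂ := ∫ x, |divergence h₂ x|
  have hM₁0 : 0 ≤ M₁ := (norm_nonneg _).trans (hM₁ 0)
  have hM₂0 : 0 ≤ M₂ := (norm_nonneg _).trans (hM₂ 0)
  have step : ∀ ε : ℝ, 0 < ε → (∫ x, max (f x - c) 0 * divergence h₁ x)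
      + ∫ x, min (f x) c * divergence h₂ x ≤ (totalVar f).toReal + (M₁ + I₁ + (M₂ + I₂)) * ε := by
    intro ε hε
    obtain ⟨φ, hφ⟩ := exists_integral_abs_convolution_sub_le hf hε
    set g : RSpace n → ℝ := φ.normed volume ⋆[lsmul ℝ ℝ, volume] f with hg
    have hgi : Integrable g := φ.integrable_normed.integrable_convolution _ hf
    have hgc : ContDiff ℝ 1 g := φ.hasCompactSupport_normed.contDiff_convolution_left (n := 1) _
      φ.contDiff_normed hf.locallyIntegrable
    have hpc : Continuous fun x => smoothPos ε (g x - c) :=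
      (contDiff_smoothPos hε).continuous.comp (hgc.continuous.sub continuous_const)
    have hsplit := (integral_smooth_split hε hgc c hh₁ hh₂).trans (totalVar_convolution_le φ hf)
    rw [ENNReal.ofReal_le_iff_le_toReal htop] at hsplit
    have hmax : ∀ x, |max (f x - c) 0 - smoothPos ε (g x - c)| ≤ |g x - f x| + ε := by
      intro x
      have h1 := abs_smoothPos_sub_le hε (g x - c)
      have h2 : |max (f x - c) 0 - max (g x - c) 0| ≤ |(f x - c) - (g x - c)| :=
        abs_max_sub_max_le_abs _ _ _
      rw [show (f x - c) - (g x - c) = -(g x - f x) by ring, abs_neg] at h2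
      rw [abs_sub_comm] at h1
      calc _ = |(max (f x - c) 0 - max (g x - c) 0)
            + (max (g x - c) 0 - smoothPos ε (g x - c))| := by ring_nf
        _ ≤ _ := (abs_add_le _ _).trans (add_le_add h2 h1)
    have hmin : ∀ x, |min (f x) c - (g x - smoothPos ε (g x - c))| ≤ |g x - f x| + ε := by
      intro x
      have h1 := abs_smoothPos_sub_le hε (g x - c)
      have h2 : |min (f x) c - min (g x) c| ≤ |f x - g x| := by
        simpa using abs_min_sub_min_le_max (f x) c (g x) c
      have h3 : min (g x) c = g x - max (g x - c) 0 := by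
        rcases le_total (g x) c with h | h
        · rw [min_eq_left h, max_eq_right (by linarith), sub_zero]
        · rw [min_eq_right h, max_eq_left (by linarith), sub_sub_cancel]
      rw [abs_sub_comm (f x)] at h2
      calc _ = |(min (f x) c - min (g x) c)
            + (smoothPos ε (g x - c) - max (g x - c) 0)| := by rw [h3]; ring_nf
        _ ≤ _ := (abs_add_le _ _).trans (add_le_add h2 h1)
    have hA := integral_mul_le_add (δ := ε)
      (integrable_mul_of_abs_le hf (K := |c|) (by have := hf.aestronglyMeasurable; fun_prop)
        (fun x => by
          rw [abs_of_nonneg (le_max_right _ _)]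
          refine max_le ?_ (by positivity)
          linarith [le_abs_self (f x), neg_abs_le c]) hc₁ hs₁)
      ((hpc.mul hc₁).integrable_of_hasCompactSupport hs₁.mul_left)
      (hgi.sub hf) (hc₁.integrable_of_hasCompactSupport hs₁) hM₁ hmax
    have hB := integral_mul_le_add (δ := ε)
      (integrable_mul_of_abs_le hf (K := |c|) (by have := hf.aestronglyMeasurable; fun_prop)
        (fun x => by
          refine abs_min_le_max_abs_abs.trans (max_le ?_ ?_) <;>
          linarith [abs_nonneg (f x), abs_nonneg c]) hc₂ hs₂)
      (((hgc.continuous.sub hpc).mul hc₂).integrable_of_hasCompactSupport hs₂.mul_left)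
      (hgi.sub hf) (hc₂.integrable_of_hasCompactSupport hs₂) hM₂ hmin
    simp only [Pi.sub_apply] at hA hB
    have k1 := mul_le_mul_of_nonneg_left hφ hM₁0
    have k2 := mul_le_mul_of_nonneg_left hφ hM₂0
    nlinarith
  have hlim : Tendsto (fun ε : ℝ => (totalVar f).toReal + (M₁ + I₁ + (M₂ + I₂)) * ε) (𝓝[>] 0)
      (𝓝 ((totalVar f).toReal + (M₁ + I₁ + (M₂ + I₂)) * 0)) :=
    ((continuous_const.add (continuous_const.mul continuous_id)).tendsto 0).mono_left
      nhdsWithin_le_nhds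
  simp only [mul_zero, add_zero] at hlim
  exact ge_of_tendsto hlim (eventually_mem_nhdsWithin.mono step)

theorem isTestField_zero (U : Set (RSpace n)) : IsTestField U 0 where
  contDiff := contDiff_const
  hasCompactSupport := HasCompactSupport.zero
  tsupport_subset := by simp [tsupport]
  norm_le_one := fun x => by simp

/-- The total variation splits along the level `c`. -/
theorem totalVar_posPart_add_totalVar_min_le {f : RSpace n → ℝ} (hf : Integrable f) (c : ℝ) :
    totalVar (fun x => max (f x - c) 0) + totalVar (fun x => min (f x) c) ≤ totalVar f := by
  refine ENNReal.biSup_add_biSup_le' (p := IsTestField univ) (q := IsTestField univ)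
    ⟨0, isTestField_zero _⟩ ⟨0, isTestField_zero _⟩ fun h₁ hh₁ h₂ hh₂ => ?_
  have h0 : ∀ x, divergence (0 : RSpace n → RSpace n) x = 0 := fun x => by simp [divergence]
  have k12 := ofReal_integral_split_le hf c hh₁ hh₂
  -- `ENNReal.ofReal` truncates negative integrals to `0`, so a negative term is handled by taking
  -- the zero field in its place.
  have k1 := ofReal_integral_split_le hf c hh₁ (isTestField_zero univ)
  have k2 := ofReal_integral_split_le hf c (isTestField_zero univ) hh₂
  simp only [h0, mul_zero, integral_zero, add_zero, zero_add] at k1 k2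
  rcases le_total 0 (∫ x, max (f x - c) 0 * divergence h₁ x) with p1 | p1
  · rcases le_total 0 (∫ x, min (f x) c * divergence h₂ x) with p2 | p2
    · rwa [← ENNReal.ofReal_add p1 p2]
    · rwa [ENNReal.ofReal_of_nonpos p2, add_zero]
  · rwa [ENNReal.ofReal_of_nonpos p1, zero_add]

/-- Lower semicontinuity of the total variation under dominated pointwise convergence. -/
theorem totalVar_le_of_tendsto {ι : Type*} {l : Filter ι} [l.NeBot] [l.IsCountablyGenerated]
    {F : ι → RSpace n → ℝ} {f g : RSpace n → ℝ} {K : ℝ} {t : ι → ℝ≥0∞} {T : ℝ≥0∞}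
    (hF : ∀ᶠ i in l, AEStronglyMeasurable (F i) volume) (hg : Integrable g)
    (hb : ∀ᶠ i in l, ∀ x, |F i x| ≤ |g x| + K) (hlim : ∀ x, Tendsto (fun i => F i x) l (𝓝 (f x)))
    (ht : ∀ᶠ i in l, totalVar (F i) ≤ t i) (hT : Tendsto t l (𝓝 T)) : totalVar f ≤ T := by
  refine iSup₂_le fun h hh => ?_
  have hc := continuous_divergence hh.contDiff
  have hs := hasCompactSupport_divergence hh.hasCompactSupport
  have hlim' : Tendsto (fun i => ∫ x, F i x * divergence h x) l
      (𝓝 (∫ x, f x * divergence h x)) := by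
    have hbi : Integrable fun x => (|g x| + |K|) * divergence h x :=
      integrable_mul_of_abs_le hg (K := |K|)
        (hg.abs.aestronglyMeasurable.add aestronglyMeasurable_const)
        (fun x => by rw [abs_of_nonneg (by positivity)]) hc hs
    refine tendsto_integral_filter_of_dominated_convergence _ ?_ ?_ hbi.abs ?_
    · exact hF.mono fun i hi => hi.mul hc.aestronglyMeasurable
    · refine hb.mono fun i hi => Eventually.of_forall fun x => ?_
      rw [Real.norm_eq_abs, abs_mul, abs_mul]
      refine mul_le_mul_of_nonneg_right ?_ (abs_nonneg _)
      rw [abs_of_nonneg (by positivity : (0 : ℝ) ≤ |g x| + |K|)]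
      linarith [hi x, le_abs_self K]
    · exact Eventually.of_forall fun x => (hlim x).mul_const _
  exact le_of_tendsto_of_tendsto (ENNReal.tendsto_ofReal hlim') hT
    (ht.mono fun i hi => (ofReal_integral_le_totalVar hh).trans hi)

/-! ### Variation above a level and perimeters of superlevel sets. -/

/-- The total variation of the part of `u` above the level `a`. -/
noncomputable def upperVar (u : RSpace n → ℝ) (a : ℝ) : ℝ≥0∞ := totalVar fun x => max (u x - a) 0

section UpperVar

variable {u : RSpace n → ℝ}

theorem integrable_max_sub (hu : Integrable u) {a : ℝ} (ha : 0 ≤ a) :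
    Integrable fun x => max (u x - a) 0 := by
  refine hu.mono (by have := hu.aestronglyMeasurable; fun_prop)
    (Eventually.of_forall fun x => ?_)
  rw [Real.norm_eq_abs, Real.norm_eq_abs, abs_of_nonneg (le_max_right _ _)]
  exact max_le (by linarith [le_abs_self (u x)]) (abs_nonneg _)

theorem layer_add_upperVar_le (hu : Integrable u) {a b : ℝ} (ha : 0 ≤ a) (hab : a ≤ b) :
    totalVar (fun x => min (max (u x - a) 0) (b - a)) + upperVar u b ≤ upperVar u a := by
  have h := totalVar_posPart_add_totalVar_min_le (integrable_max_sub hu ha) (b - a)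
  have e : (fun x => max (max (u x - a) 0 - (b - a)) 0) = fun x => max (u x - b) 0 := by
    ext x
    rcases le_total (u x - a) 0 with h | h
    · rw [max_eq_right h, max_eq_right (by linarith), max_eq_right (by linarith)]
    · rw [max_eq_left h, sub_sub_sub_cancel_right]
  rw [e, add_comm] at h
  exact h

theorem upperVar_anti (hu : Integrable u) {a b : ℝ} (ha : 0 ≤ a) (hab : a ≤ b) :
    upperVar u b ≤ upperVar u a :=
  le_add_self.trans (layer_add_upperVar_le hu ha hab)

theorem upperVar_le (hu : Integrable u) (a : ℝ) : upperVar u a ≤ totalVar u :=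
  le_self_add.trans (totalVar_posPart_add_totalVar_min_le hu a)

/-- If the limit were `e > 0`, every `min(u, k)` would have variation at most `TV(u) - e`; lower
semicontinuity as `k → ∞` then contradicts finiteness of `TV(u)`. -/
theorem tendsto_upperVar (hu : Integrable u) (hTV : totalVar u < ∞) :
    Tendsto (fun k : ℕ => upperVar u k) atTop (𝓝 0) := by
  have hanti : Antitone fun k : ℕ => upperVar u k := fun i j hij =>
    upperVar_anti hu (Nat.cast_nonneg i) (Nat.cast_le.2 hij)
  have hlim := tendsto_atTop_iInf hanti
  set e := ⨅ k : ℕ, upperVar u k with he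
  have heTV : e ≤ totalVar u := (iInf_le _ 0).trans (upperVar_le hu _)
  have h1 : totalVar u ≤ totalVar u - e := by
    refine totalVar_le_of_tendsto (l := atTop) (F := fun (k : ℕ) x => min (u x) k) (g := u) (K := 0)
      (t := fun _ => totalVar u - e) (Eventually.of_forall fun k => ?_) hu
      (Eventually.of_forall fun k x => ?_) (fun x => ?_) (Eventually.of_forall fun k => ?_)
      tendsto_const_nhds
    · have := hu.aestronglyMeasurable
      fun_prop
    · rw [add_zero, abs_le]
      have hk : (0 : ℝ) ≤ k := Nat.cast_nonneg k
      exact ⟨le_min (neg_abs_le _) (by linarith [abs_nonneg (u x)]),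
        (min_le_left _ _).trans (le_abs_self _)⟩
    · obtain ⟨N, hN⟩ := exists_nat_ge (u x)
      refine tendsto_const_nhds.congr' ?_
      filter_upwards [eventually_ge_atTop N] with k hk
      rw [min_eq_left (hN.trans (Nat.cast_le.2 hk))]
    · refine ENNReal.le_sub_of_add_le_left (heTV.trans_lt hTV).ne ?_
      refine le_trans ?_ (totalVar_posPart_add_totalVar_min_le hu (k : ℝ))
      exact add_le_add (iInf_le _ k) le_rfl
  have h2 : e = 0 := by
    by_contra h0
    exact absurd h1 (not_le.2 (ENNReal.sub_lt_self hTV.ne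
      (fun h => h0 (le_antisymm (heTV.trans h.le) zero_le)) h0))
  rwa [h2] at hlim

/-- The functions `ε⁻¹ min((u - s)⁺, ε)` converge pointwise to `χ_{u > s}` as `ε ↓ 0`, and their
variations are at most the difference quotients of `-upperVar u`. -/
theorem totalVar_superlevel_le_of_hasDerivAt (hu : Integrable u) (hTV : totalVar u < ∞) {s m : ℝ}
    (hs : 0 ≤ s) (hd : HasDerivAt (fun t => -(upperVar u (max t 0)).toReal) m s) :
    totalVar ({x | s < u x}.indicator fun _ => (1 : ℝ)) ≤ ENNReal.ofReal m := by
  have hfin : ∀ a, upperVar u a ≠ ∞ := fun a => ((upperVar_le hu a).trans_lt hTV).ne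
  have hslope := ENNReal.tendsto_ofReal (hasDerivAt_iff_tendsto_slope_zero.1 hd |>.mono_left
    (nhdsWithin_mono 0 (fun t (ht : t ∈ Ioi (0 : ℝ)) => ne_of_gt ht)))
  refine totalVar_le_of_tendsto (l := 𝓝[>] (0 : ℝ)) (g := 0) (K := 1)
    (F := fun ε => ε⁻¹ • fun x => min (max (u x - s) 0) (s + ε - s))
    ?_ (integrable_zero _ _ _) ?_ (fun x => ?_) ?_ hslope
  · refine Eventually.of_forall fun ε => ?_
    have := hu.aestronglyMeasurable
    refine AEStronglyMeasurable.const_smul ?_ _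
    fun_prop
  · filter_upwards [self_mem_nhdsWithin] with ε (hε : 0 < ε) x
    simp only [Pi.smul_apply, smul_eq_mul, add_sub_cancel_left, Pi.zero_apply, abs_zero, zero_add]
    rw [abs_mul, abs_of_pos (inv_pos.2 hε), abs_of_nonneg (le_min (le_max_right _ _) hε.le),
      inv_mul_le_iff₀ hε, mul_one]
    exact min_le_right _ _
  · simp only [Pi.smul_apply, smul_eq_mul, add_sub_cancel_left]
    refine tendsto_const_nhds.congr' ?_
    by_cases hx : s < u x
    · filter_upwards [Ioo_mem_nhdsGT (sub_pos.2 hx)] with ε hε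
      rw [indicator_of_mem (show x ∈ {x | s < u x} from hx),
        max_eq_left (sub_pos.2 hx).le, min_eq_right hε.2.le, inv_mul_cancel₀ hε.1.ne']
    · filter_upwards [self_mem_nhdsWithin] with ε (hε : 0 < ε)
      rw [indicator_of_notMem (show x ∉ {x | s < u x} from hx),
        max_eq_right (by linarith [not_lt.1 hx]), min_eq_left hε.le, mul_zero]
  · filter_upwards [self_mem_nhdsWithin] with ε (hε : 0 < ε)
    refine (totalVar_smul_le _ _).trans ?_
    rw [abs_of_pos (inv_pos.2 hε), smul_eq_mul, ENNReal.ofReal_mul (inv_pos.2 hε).le]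
    gcongr
    rw [max_eq_left hs, max_eq_left (by linarith)]
    have h := layer_add_upperVar_le hu hs (by linarith : s ≤ s + ε)
    have h' := ENNReal.le_sub_of_add_le_right (hfin _) h
    refine h'.trans_eq ?_
    rw [neg_sub_neg, ENNReal.ofReal_sub _ ENNReal.toReal_nonneg, ENNReal.ofReal_toReal (hfin _),
      ENNReal.ofReal_toReal (hfin _)]

/-- A layer contains a superlevel set of controlled perimeter: a discrete form of the coarea
inequality. -/
theorem exists_superlevel (hu : Integrable u) (hTV : totalVar u < ∞) {a b : ℝ} (ha : 0 ≤ a)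
    (hab : a < b) : ∃ s ∈ Icc a b,
      ENNReal.ofReal (b - a) * totalVar ({x | s < u x}.indicator fun _ => (1 : ℝ))
        ≤ ENNReal.ofReal ((upperVar u a).toReal - (upperVar u b).toReal) := by
  have hfin : ∀ a, upperVar u a ≠ ∞ := fun a => ((upperVar_le hu a).trans_lt hTV).ne
  -- Monotonicity of `upperVar` is available only for levels `≥ 0`; freezing the level below `0`
  -- makes `V` monotone on the whole line.
  set V : ℝ → ℝ := fun t => -(upperVar u (max t 0)).toReal with hV
  have hmono : Monotone V := fun t₁ t₂ h => neg_le_neg (ENNReal.toReal_mono (hfin _)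
    (upperVar_anti hu (le_max_right _ _) (max_le_max_right 0 h)))
  have hint : IntervalIntegrable (deriv V) volume a b :=
    (hmono.monotoneOn _).intervalIntegrable_deriv
  -- For a monotone function this may be strict, but only this direction is needed.
  have hle : ∫ x in a..b, deriv V x ≤ V b - V a := by
    have := (hmono.monotoneOn (uIcc a b)).intervalIntegral_deriv_mem_uIcc
    rw [uIcc_of_le (sub_nonneg.2 (hmono hab.le))] at this
    exact this.2
  rw [intervalIntegral.integral_of_le hab.le] at hle
  have hnull : volume.restrict (Ioc a b) ({t | ¬ DifferentiableAt ℝ V t} ∪ (Ioc a b)ᶜ) = 0 := by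
    refine measure_union_null ?_ (by simp)
    exact Measure.absolutelyContinuous_of_le Measure.restrict_le_self hmono.ae_differentiableAt
  -- A point of `(a, b]` where `V` is differentiable and `V'` does not exceed its average.
  obtain ⟨s, hsN, hs⟩ := exists_notMem_null_le_average (μ := volume.restrict (Ioc a b))
    (by simp [Measure.restrict_eq_zero, hab]) hint.1 hnull
  simp only [mem_union, mem_ofPred_eq, mem_compl_iff, not_or, not_not] at hsN
  refine ⟨s, Ioc_subset_Icc_self hsN.2, ?_⟩
  have hd := totalVar_superlevel_le_of_hasDerivAt hu hTV (ha.trans hsN.2.1.le) hsN.1.hasDerivAt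
  refine (mul_le_mul_right hd _).trans ?_
  rw [← ENNReal.ofReal_mul (sub_pos.2 hab).le]
  refine ENNReal.ofReal_le_ofReal ?_
  rw [setAverage_eq] at hs
  simp only [Real.volume_real_Ioc_of_le hab.le, smul_eq_mul] at hs
  rw [inv_mul_eq_div, le_div_iff₀ (sub_pos.2 hab)] at hs
  have e : V b - V a = (upperVar u a).toReal - (upperVar u b).toReal := by
    simp only [hV, max_eq_left ha, max_eq_left (ha.trans hab.le)]
    ring
  rw [← e]
  linarith

end UpperVar

/-! ### Discretization into layers, and elements of the function space. -/

/-- Approximation of `min x (m δ)` by a step function with one jump in each layer. -/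
theorem abs_min_sub_sum_le {δ : ℝ} (hδ : 0 ≤ δ) {s : ℕ → ℝ}
    (hs : ∀ i : ℕ, s i ∈ Icc (i * δ) ((i + 1) * δ)) {x : ℝ} (hx : 0 ≤ x) (m : ℕ) :
    |min x (m * δ) - ∑ i ∈ Finset.range m, δ * (Ioi (s i)).indicator 1 x| ≤ δ ∧
      (m * δ < x → min x (m * δ) - ∑ i ∈ Finset.range m, δ * (Ioi (s i)).indicator 1 x = 0) := by
  -- The second conjunct carries the induction: above `m δ` all jumps have occurred and the error is
  -- exactly zero, so only the layer containing `x` contributes.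
  induction m with
  | zero => simp [hx, hδ]
  | succ m ih =>
    rw [Finset.sum_range_succ]
    push_cast
    rcases lt_or_ge (m * δ) x with h | h
    · have h0 := ih.2 h
      rw [min_eq_right h.le] at h0
      have h1 : m * δ ≤ min x ((m + 1) * δ) := le_min h.le (by linarith)
      have h2 : min x ((m + 1) * δ) ≤ (m + 1) * δ := min_le_right _ _
      refine ⟨?_, fun hx' => ?_⟩
      · by_cases hm : x ∈ Ioi (s m)
        · rw [indicator_of_mem hm, Pi.one_apply, abs_le]
          constructor <;> linarith
        · rw [indicator_of_notMem hm, abs_le]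
          constructor <;> linarith
      · have hm : x ∈ Ioi (s m) := (hs m).2.trans_lt hx'
        rw [indicator_of_mem hm, Pi.one_apply, min_eq_right hx'.le]
        linarith
    · have hm : x ∉ Ioi (s m) := not_lt.2 (h.trans (hs m).1)
      rw [indicator_of_notMem hm, mul_zero, add_zero, min_eq_left (by linarith)]
      rw [min_eq_left h] at ih
      exact ⟨ih.1, fun hx' => by linarith⟩

/-- The element of `bvSpace Ω` represented by a function. -/
noncomputable def bvMk (u : RSpace n → ℝ) (hu : Integrable u) (hTV : totalVar u < ∞)
    (h0 : ∀ᵐ x, x ∉ closure Ω → u x = 0) : bvSpace Ω :=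
  ⟨hu.toL1 u, (totalVar_congr hu.coeFn_toL1).trans_lt hTV, by
    filter_upwards [hu.coeFn_toL1, h0] with x hx h hx'
    rw [hx, h hx']⟩

theorem coeFn_bvMk {u : RSpace n → ℝ} (hu : Integrable u) (hTV : totalVar u < ∞)
    (h0 : ∀ᵐ x, x ∉ closure Ω → u x = 0) : (bvMk u hu hTV h0 : RSpace n → ℝ) =ᵐ[volume] u :=
  hu.coeFn_toL1

theorem isCaccioppoli_of_totalVar_lt_top {E : Set (RSpace n)} (hE : MeasurableSet E)
    (hTV : totalVar (E.indicator fun _ => (1 : ℝ)) < ∞) : IsCaccioppoli E := by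
  refine ⟨hE, fun U _ _ => lt_of_le_of_lt ?_ hTV⟩
  refine iSup₂_le fun h hh => ofReal_integral_le_totalVar ?_
  exact ⟨hh.contDiff, hh.hasCompactSupport, subset_univ _, hh.norm_le_one⟩

/-! ### From characteristic functions to all functions, for a seminorm. -/

section Seminorm

variable {A : Set (RSpace n)} {N : bvSpace Ω → ℝ≥0∞} {C K : ℝ≥0}

theorem seminorm_sum_le (hadd : ∀ f g, N (f + g) ≤ N f + N g)
    (hsmul : ∀ (c : ℝ) f, N (c • f) ≤ ENNReal.ofReal |c| * N f) {ι : Type*} (s : Finset ι)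
    (F : ι → bvSpace Ω) : N (∑ i ∈ s, F i) ≤ ∑ i ∈ s, N (F i) := by
  classical
  induction s using Finset.induction_on with
  | empty => simpa using hsmul 0 0
  | insert i s hi ih =>
    rw [Finset.sum_insert hi, Finset.sum_insert hi]
    exact (hadd _ _).trans (by gcongr)

theorem coeFn_bvSpace_sum {ι : Type*} (s : Finset ι) (F : ι → bvSpace Ω) :
    ((∑ i ∈ s, F i : bvSpace Ω) : RSpace n → ℝ) =ᵐ[volume]
      fun x => ∑ i ∈ s, (F i : RSpace n → ℝ) x := by
  have e : ((∑ i ∈ s, F i : bvSpace Ω) : Lp ℝ 1 (volume : Measure (RSpace n)))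
      = ∑ i ∈ s, (F i : Lp ℝ 1 (volume : Measure (RSpace n))) := Submodule.coe_sum _ _ _
  rw [e]
  exact Lp.coeFn_fun_finsetSum s fun i => (F i : Lp ℝ 1 (volume : Measure (RSpace n)))

/-- The bound for a nonnegative function, up to the errors made by cutting off at height `m δ` and
by discretizing with step `δ`. -/
theorem seminorm_le_of_nonneg_aux (hadd : ∀ f g, N (f + g) ≤ N f + N g)
    (hsmul : ∀ (c : ℝ) f, N (c • f) ≤ ENNReal.ofReal |c| * N f)
    (hTV : ∀ f : bvSpace Ω, N f ≤ C * totalVar (f : RSpace n → ℝ))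
    (hinf : ∀ f : bvSpace Ω, N f ≤ C * eLpNorm (f : RSpace n → ℝ) ∞ volume)
    (hΩ : Bornology.IsBounded Ω) (hA : MeasurableSet A) (hAΩ : A ⊆ closure Ω)
    (htest : ∀ (f : bvSpace Ω) (E : Set (RSpace n)), E ⊆ A → IsCaccioppoli E → IsCharFun f E →
      N f ≤ K * totalVar (f : RSpace n → ℝ))
    {u : RSpace n → ℝ} (hum : Measurable u) (hu : Integrable u) (huTV : totalVar u < ∞)
    (hu0 : ∀ x, 0 ≤ u x) (huA : ∀ᵐ x, x ∉ A → u x = 0) (h0 : ∀ᵐ x, x ∉ closure Ω → u x = 0)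
    {δ : ℝ} (hδ : 0 < δ) (m : ℕ) :
    N (bvMk u hu huTV h0) ≤ C * upperVar u (m * δ) + C * ENNReal.ofReal δ + K * totalVar u := by
  have hfin : ∀ a, upperVar u a ≠ ∞ := fun a => ((upperVar_le hu a).trans_lt huTV).ne
  have hi0 : ∀ i : ℕ, (0 : ℝ) ≤ i * δ := fun i => by positivity
  choose s hs hsv using fun i : ℕ =>
    exists_superlevel hu huTV (hi0 i) (by linarith : i * δ < (i + 1) * δ)
  have hs0 : ∀ i, 0 ≤ s i := fun i => (hi0 i).trans (hs i).1
  -- Intersecting with `A` makes the sets admissible tests. It changes them only by null sets,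
  -- because `u = 0` almost everywhere off `A` and `s i ≥ 0`.
  set E : ℕ → Set (RSpace n) := fun i => {x | s i < u x} ∩ A with hE
  have hEm : ∀ i, MeasurableSet (E i) := fun i => (measurableSet_lt measurable_const hum).inter hA
  have hEae : ∀ i, (E i).indicator (fun _ => (1 : ℝ)) =ᵐ[volume]
      {x | s i < u x}.indicator fun _ => (1 : ℝ) := by
    intro i
    filter_upwards [huA] with x hx
    by_cases hxA : x ∈ A
    · simp [hE, indicator, hxA]
    · simp [hE, indicator, hxA, hx hxA, hs0 i]
  have hsub : ∀ i, (i + 1 : ℝ) * δ - i * δ = δ := fun i => by ring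
  have hETV : ∀ i, ENNReal.ofReal δ * totalVar ((E i).indicator fun _ => (1 : ℝ))
      ≤ ENNReal.ofReal ((upperVar u (i * δ)).toReal - (upperVar u ((i + 1) * δ)).toReal) := by
    intro i
    have := hsv i
    rwa [hsub, ← totalVar_congr (hEae i)] at this
  have hEfin : ∀ i, totalVar ((E i).indicator fun _ => (1 : ℝ)) < ∞ := by
    intro i
    refine lt_top_iff_ne_top.2 fun h => ?_
    have := hETV i
    rw [h, ENNReal.mul_top (by simpa using hδ)] at this
    exact ENNReal.ofReal_ne_top (top_le_iff.1 this)
  have hEi : ∀ i, Integrable ((E i).indicator fun _ => (1 : ℝ)) := fun i =>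
    (integrable_indicator_iff (hEm i)).2 (integrableOn_const
      ((hΩ.closure.subset (inter_subset_right.trans hAΩ)).measure_lt_top.ne))
  have hE0 : ∀ i, ∀ᵐ x, x ∉ closure Ω → (E i).indicator (fun _ => (1 : ℝ)) x = 0 := fun i =>
    Eventually.of_forall fun x hx => indicator_of_notMem (fun h => hx (hAΩ h.2)) _
  set χ : ℕ → bvSpace Ω := fun i => bvMk _ (hEi i) (hEfin i) (hE0 i) with hχ
  have hχE : ∀ i, (χ i : RSpace n → ℝ) =ᵐ[volume] (E i).indicator fun _ => (1 : ℝ) :=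
    fun i => coeFn_bvMk (hEi i) (hEfin i) (hE0 i)
  set L : ℝ := m * δ with hL
  have hL0 : 0 ≤ L := hi0 m
  have hvi : Integrable fun x => min (u x) L := by
    refine hu.mono (by have := hu.aestronglyMeasurable; fun_prop) (Eventually.of_forall fun x => ?_)
    rw [Real.norm_of_nonneg (le_min (hu0 x) hL0), Real.norm_of_nonneg (hu0 x)]
    exact min_le_left _ _
  have hvTV : totalVar (fun x => min (u x) L) < ∞ :=
    (le_add_self.trans (totalVar_posPart_add_totalVar_min_le hu L)).trans_lt huTV
  have hv0 : ∀ᵐ x, x ∉ closure Ω → min (u x) L = 0 := by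
    filter_upwards [h0] with x hx hx'
    rw [hx hx', min_eq_left hL0]
  set f := bvMk u hu huTV h0
  set v := bvMk _ hvi hvTV hv0
  have hfu : (f : RSpace n → ℝ) =ᵐ[volume] u := coeFn_bvMk hu huTV h0
  have hvu : (v : RSpace n → ℝ) =ᵐ[volume] fun x => min (u x) L := coeFn_bvMk hvi hvTV hv0
  -- The three terms are controlled by the variation bound, the sup norm bound and the test
  -- hypothesis respectively.
  have hdec : f = (f - v) + (v - ∑ i ∈ Finset.range m, δ • χ i)
      + ∑ i ∈ Finset.range m, δ • χ i := by abel
  have b1 : N (f - v) ≤ C * upperVar u L := by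
    refine (hTV _).trans_eq ?_
    congr 1
    refine totalVar_congr ?_
    filter_upwards [hfu, hvu, Lp.coeFn_sub (f : Lp ℝ 1 (volume : Measure (RSpace n))) v]
      with x h1 h2 h3
    rw [Submodule.coe_sub, h3, Pi.sub_apply, h1, h2]
    rcases le_total (u x) L with h | h
    · rw [min_eq_left h, max_eq_right (by linarith), sub_self]
    · rw [min_eq_right h, max_eq_left (by linarith)]
  have b2 : N (v - ∑ i ∈ Finset.range m, δ • χ i) ≤ C * ENNReal.ofReal δ := by
    refine (hinf _).trans ?_
    gcongr
    refine eLpNormEssSup_le_of_ae_bound (C := δ) ?_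
    have hall : ∀ᵐ x, ∀ i : ℕ, (χ i : RSpace n → ℝ) x
        = {x | s i < u x}.indicator (fun _ => (1 : ℝ)) x :=
      ae_all_iff.2 fun i => (hχE i).trans (hEae i)
    have hall' : ∀ᵐ x, ∀ i : ℕ, ((δ • χ i : bvSpace Ω) : RSpace n → ℝ) x
        = δ * (χ i : RSpace n → ℝ) x :=
      ae_all_iff.2 fun i => Lp.coeFn_smul δ (χ i : Lp ℝ 1 (volume : Measure (RSpace n)))
    filter_upwards [hall, hall', hvu, coeFn_bvSpace_sum (Finset.range m) fun i => δ • χ i,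
      Lp.coeFn_sub (v : Lp ℝ 1 (volume : Measure (RSpace n)))
        (∑ i ∈ Finset.range m, δ • χ i : bvSpace Ω)] with x h1 h2 h3 h4 h5
    rw [Submodule.coe_sub, h5, Pi.sub_apply, h3, h4, Real.norm_eq_abs]
    refine le_trans (le_of_eq ?_) (abs_min_sub_sum_le hδ.le hs (hu0 x) m).1
    congr 2
    refine Finset.sum_congr rfl fun i _ => ?_
    rw [h2, h1]
    simp [indicator]
  have b3 : N (∑ i ∈ Finset.range m, δ • χ i) ≤ K * totalVar u := by
    have hterm : ∀ i ∈ Finset.range m, N (δ • χ i) ≤ K * ENNReal.ofReal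
        ((upperVar u (i * δ)).toReal - (upperVar u ((i + 1 : ℕ) * δ)).toReal) := by
      intro i _
      refine (hsmul _ _).trans ?_
      rw [abs_of_pos hδ]
      refine (mul_le_mul_right (htest (χ i) (E i) inter_subset_right
        (isCaccioppoli_of_totalVar_lt_top (hEm i) (hEfin i)) (hχE i)) _).trans ?_
      rw [totalVar_congr (hχE i), mul_left_comm]
      push_cast
      gcongr
      exact hETV i
    refine (seminorm_sum_le hadd hsmul _ _).trans ((Finset.sum_le_sum hterm).trans ?_)
    rw [← Finset.mul_sum]
    gcongr
    -- The sum is taken in `ℝ` so that it telescopes to `V(0) - V(mδ)`.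
    rw [← ENNReal.ofReal_sum_of_nonneg fun i _ => ?_]
    · rw [Finset.sum_range_sub' fun i : ℕ => (upperVar u (i * δ)).toReal]
      refine (ENNReal.ofReal_le_ofReal (sub_le_self _ ENNReal.toReal_nonneg)).trans ?_
      rw [ENNReal.ofReal_toReal (hfin _)]
      exact upperVar_le hu _
    · refine sub_nonneg.2 (ENNReal.toReal_mono (hfin _) (upperVar_anti hu (hi0 i) ?_))
      push_cast
      linarith
  calc N f ≤ N (f - v) + N (v - ∑ i ∈ Finset.range m, δ • χ i)
        + N (∑ i ∈ Finset.range m, δ • χ i) := by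
        conv_lhs => rw [hdec]
        exact (hadd _ _).trans (add_le_add_left (hadd _ _) _)
    _ ≤ _ := add_le_add (add_le_add b1 b2) b3

theorem seminorm_le_of_nonneg (hadd : ∀ f g, N (f + g) ≤ N f + N g)
    (hsmul : ∀ (c : ℝ) f, N (c • f) ≤ ENNReal.ofReal |c| * N f)
    (hTV : ∀ f : bvSpace Ω, N f ≤ C * totalVar (f : RSpace n → ℝ))
    (hinf : ∀ f : bvSpace Ω, N f ≤ C * eLpNorm (f : RSpace n → ℝ) ∞ volume)
    (hΩ : Bornology.IsBounded Ω) (hA : MeasurableSet A) (hAΩ : A ⊆ closure Ω)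
    (htest : ∀ (f : bvSpace Ω) (E : Set (RSpace n)), E ⊆ A → IsCaccioppoli E → IsCharFun f E →
      N f ≤ K * totalVar (f : RSpace n → ℝ))
    {u : RSpace n → ℝ} (hum : Measurable u) (hu : Integrable u) (huTV : totalVar u < ∞)
    (hu0 : ∀ x, 0 ≤ u x) (huA : ∀ᵐ x, x ∉ A → u x = 0) (h0 : ∀ᵐ x, x ∉ closure Ω → u x = 0) :
    N (bvMk u hu huTV h0) ≤ K * totalVar u := by
  -- The choice `δ = 1/(k+1)`, `m = (k+1)²` gives cutoff height `mδ = k+1`, so both errors vanish as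
  -- `k → ∞`.
  have key : ∀ k : ℕ, N (bvMk u hu huTV h0) ≤ C * upperVar u ((k + 1 : ℕ) : ℝ)
      + C * ENNReal.ofReal (1 / ((k : ℝ) + 1)) + K * totalVar u := by
    intro k
    have := seminorm_le_of_nonneg_aux hadd hsmul hTV hinf hΩ hA hAΩ htest hum hu huTV hu0 huA h0
      (Nat.one_div_pos_of_nat (α := ℝ) (n := k)) ((k + 1) ^ 2)
    convert this using 5
    push_cast
    field_simp
  have t1 : Tendsto (fun k : ℕ => C * upperVar u ((k + 1 : ℕ) : ℝ)) atTop (𝓝 (C * 0)) :=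
    ENNReal.Tendsto.const_mul ((tendsto_upperVar hu huTV).comp (tendsto_add_atTop_nat 1))
      (Or.inr ENNReal.coe_ne_top)
  have t2 : Tendsto (fun k : ℕ => C * ENNReal.ofReal (1 / ((k : ℝ) + 1))) atTop
      (𝓝 (C * ENNReal.ofReal 0)) :=
    ENNReal.Tendsto.const_mul (ENNReal.tendsto_ofReal tendsto_one_div_add_atTop_nhds_zero_nat)
      (Or.inr ENNReal.coe_ne_top)
  have t3 := (t1.add t2).add_const (K * totalVar u)
  simp only [ENNReal.ofReal_zero, mul_zero, zero_add] at t3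
  exact ge_of_tendsto' t3 key

/-- A seminorm that is controlled by the total variation and by the sup norm, and on characteristic
functions of Caccioppoli sets by `K` times the perimeter, is bounded by `K` times the total
variation. -/
theorem seminorm_le_totalVar (hadd : ∀ f g, N (f + g) ≤ N f + N g)
    (hsmul : ∀ (c : ℝ) f, N (c • f) ≤ ENNReal.ofReal |c| * N f)
    (hTV : ∀ f : bvSpace Ω, N f ≤ C * totalVar (f : RSpace n → ℝ))
    (hinf : ∀ f : bvSpace Ω, N f ≤ C * eLpNorm (f : RSpace n → ℝ) ∞ volume)
    (hΩ : Bornology.IsBounded Ω) (hA : MeasurableSet A) (hAΩ : A ⊆ closure Ω)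
    (hAae : volume (closure Ω \ A) = 0)
    (htest : ∀ (f : bvSpace Ω) (E : Set (RSpace n)), E ⊆ A → IsCaccioppoli E → IsCharFun f E →
      N f ≤ K * totalVar (f : RSpace n → ℝ)) (f : bvSpace Ω) :
    N f ≤ K * totalVar (f : RSpace n → ℝ) := by
  set w : RSpace n → ℝ := (f : RSpace n → ℝ) with hw
  have hwm : Measurable w := (Lp.stronglyMeasurable _).measurable
  have hwi : Integrable w := L1.integrable_coeFn _
  have hwTV : totalVar w < ∞ := f.2.1
  have hw0 : ∀ᵐ x, x ∉ closure Ω → w x = 0 := f.2.2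
  have hwA : ∀ᵐ x, x ∉ A → w x = 0 := by
    filter_upwards [hw0, measure_eq_zero_iff_ae_notMem.1 hAae] with x h1 h2 h3
    exact h1 fun hx => h2 ⟨hx, h3⟩
  -- At level `0` the lower part is minus the negative part, so the variations of `w⁺` and `w⁻` add
  -- up to at most that of `w`, and the constant `K` is not lost.
  have hsplit := totalVar_posPart_add_totalVar_min_le hwi 0
  simp only [sub_zero] at hsplit
  have hneg : totalVar (fun x => max (-w x) 0) ≤ totalVar (fun x => min (w x) 0) := by
    have e : (fun x => max (-w x) 0) = (-1 : ℝ) • fun x => min (w x) 0 := by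
      ext x
      simp [← max_neg_neg]
    rw [e]
    simpa using totalVar_smul_le (-1) fun x => min (w x) 0
  have hp : totalVar (fun x => max (w x) 0) < ∞ := (le_self_add.trans hsplit).trans_lt hwTV
  have hm : totalVar (fun x => max (-w x) 0) < ∞ :=
    (hneg.trans (le_add_self.trans hsplit)).trans_lt hwTV
  have hz : ∀ {B : Set (RSpace n)}, (∀ᵐ x, x ∉ B → w x = 0) →
      (∀ᵐ x, x ∉ B → max (w x) 0 = 0) ∧ ∀ᵐ x, x ∉ B → max (-w x) 0 = 0 := fun h =>
    ⟨h.mono fun x hx hB => by simp [hx hB], h.mono fun x hx hB => by simp [hx hB]⟩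
  have k1 := seminorm_le_of_nonneg hadd hsmul hTV hinf hΩ hA hAΩ htest (hwm.max measurable_const)
    hwi.pos_part hp (fun x => le_max_right _ _) (hz hwA).1 (hz hw0).1
  have k2 := seminorm_le_of_nonneg hadd hsmul hTV hinf hΩ hA hAΩ htest
    (hwm.neg.max measurable_const) hwi.neg_part hm (fun x => le_max_right _ _) (hz hwA).2
    (hz hw0).2
  set f₁ := bvMk _ hwi.pos_part hp (hz hw0).1
  set f₂ := bvMk _ hwi.neg_part hm (hz hw0).2
  have hf : f = f₁ + (-1 : ℝ) • f₂ := by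
    refine Subtype.ext (Lp.ext ?_)
    filter_upwards [coeFn_bvMk hwi.pos_part hp (hz hw0).1, coeFn_bvMk hwi.neg_part hm (hz hw0).2,
      Lp.coeFn_add (f₁ : Lp ℝ 1 (volume : Measure (RSpace n))) ((-1 : ℝ) • f₂ : bvSpace Ω),
      Lp.coeFn_smul (-1 : ℝ) (f₂ : Lp ℝ 1 (volume : Measure (RSpace n)))] with x h1 h2 h3 h4
    rw [Submodule.coe_add, h3, Pi.add_apply, Submodule.coe_smul, h4, Pi.smul_apply, h1, h2]
    rcases le_total 0 (w x) with h | h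
    · rw [max_eq_left h, max_eq_right (by linarith)]
      simp [hw]
    · rw [max_eq_right h, max_eq_left (by linarith)]
      simp [hw]
  calc N f ≤ N f₁ + N f₂ := by
        conv_lhs => rw [hf]
        refine (hadd _ _).trans (add_le_add le_rfl ?_)
        simpa using hsmul (-1) f₂
    _ ≤ K * totalVar (fun x => max (w x) 0) + K * totalVar (fun x => max (-w x) 0) :=
        add_le_add k1 k2
    _ ≤ K * totalVar w := by
        rw [← mul_add]
        gcongr
        exact (add_le_add le_rfl hneg).trans hsplit

end Seminorm

/-! ### The standard deviation as a seminorm. -/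

section NoiseSD

variable {T : bvSpace Ω →ₗ[ℝ] Y} {G : S → Y} {P : Measure S}

theorem noiseSD_eq_eLpNorm (f : bvSpace Ω) : noiseSD T G P f
    = eLpNorm (fun ω => inner ℝ (T f) (G ω) - ∫ ω, inner ℝ (T f) (G ω) ∂P) 2 P := by
  rw [noiseSD, evariance, eLpNorm_eq_lintegral_rpow_enorm_toReal two_ne_zero ENNReal.ofNat_ne_top]
  simp

theorem noiseSD_smul (c : ℝ) (f : bvSpace Ω) :
    noiseSD T G P (c • f) = ENNReal.ofReal |c| * noiseSD T G P f := by
  unfold noiseSD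
  simp_rw [map_smul, inner_smul_left]
  rw [show (starRingEnd ℝ) c = c from rfl, evariance_mul,
    ENNReal.mul_rpow_of_nonneg _ _ (by norm_num), ← sq_abs,
    ENNReal.ofReal_rpow_of_nonneg (by positivity) (by norm_num), ← Real.sqrt_eq_rpow,
    Real.sqrt_sq (abs_nonneg c)]

theorem noiseSD_add_le [IsProbabilityMeasure P]
    (hG : ∀ y : Y, AEMeasurable (fun ω => inner ℝ y (G ω)) P)
    (hfin : ∀ f, noiseSD T G P f < ∞) (f g : bvSpace Ω) :
    noiseSD T G P (f + g) ≤ noiseSD T G P f + noiseSD T G P g := by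
  have hL : ∀ f, MemLp (fun ω => inner ℝ (T f) (G ω)) 2 P := by
    intro f
    rw [← evariance_lt_top_iff_memLp (hG _).aestronglyMeasurable]
    exact (ENNReal.rpow_lt_top_iff_of_pos (by norm_num)).1 (hfin f)
  have hI : ∀ f, Integrable (fun ω => inner ℝ (T f) (G ω)) P := fun f =>
    (hL f).integrable (by norm_num)
  simp only [noiseSD_eq_eLpNorm]
  refine le_trans (le_of_eq ?_) (eLpNorm_add_le (((hL f).1).sub aestronglyMeasurable_const)
    (((hL g).1).sub aestronglyMeasurable_const) (by norm_num))
  congr 1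
  ext ω
  simp only [map_add, inner_add_left, Pi.add_apply]
  rw [integral_add (hI f) (hI g)]
  ring

/-- The value `∞` at `σ(f) = 0` matches the trivial inequality `0 ≤ λ ‖f‖_TV`, so no case is
exceptional. -/
theorem le_regRatio_iff {lam s₀ : ℝ≥0} {f : bvSpace Ω} (hfin : noiseSD T G P f ≠ ∞) :
    s₀ ≤ regRatio T G P lam f ↔ s₀ * noiseSD T G P f ≤ lam * totalVar (f : RSpace n → ℝ) := by
  unfold regRatio
  split_ifs with h
  · simp [h]
  · exact ENNReal.le_div_iff_mul_le (Or.inl h) (Or.inl hfin)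

end NoiseSD

end

theorem lemma2 {n : ℕ} (Ω : Set (RSpace n)) (hΩo : IsOpen Ω) (hΩb : Bornology.IsBounded Ω)
    {Y : Type*} [NormedAddCommGroup Y] [InnerProductSpace ℝ Y] [CompleteSpace Y]
    (T : bvSpace Ω →ₗ[ℝ] Y)
    {S : Type*} [MeasurableSpace S] (P : Measure S) [IsProbabilityMeasure P]
    (G : S → Y) (hG : ∀ y : Y, AEMeasurable (fun ω => inner ℝ y (G ω)) P)
    (C : ℝ≥0)
    (hTV : ∀ f : bvSpace Ω, noiseSD T G P f ≤ C * totalVar (f : RSpace n → ℝ))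
    (hLinfty : ∀ f : bvSpace Ω, noiseSD T G P f ≤ C * eLpNorm (f : RSpace n → ℝ) ∞ volume)
    (lam s₀ : ℝ≥0) (hs₀ : 0 < s₀) :
    -- the test sets are the Caccioppoli subsets of `Ω`, whose boundary is a null set
    (volume (frontier Ω) = 0 →
      (∀ (f : bvSpace Ω) (E : Set (RSpace n)), E ⊆ Ω → IsCaccioppoli E → IsCharFun f E →
        s₀ ≤ regRatio T G P lam f) →
      ∀ f : bvSpace Ω, s₀ ≤ regRatio T G P lam f) ∧
    -- arbitrary boundary: the test sets are the Caccioppoli subsets of the closure of `Ω`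
    ((∀ (f : bvSpace Ω) (E : Set (RSpace n)), E ⊆ closure Ω → IsCaccioppoli E → IsCharFun f E →
        s₀ ≤ regRatio T G P lam f) →
      ∀ f : bvSpace Ω, s₀ ≤ regRatio T G P lam f) := by
  have hfin : ∀ f, noiseSD T G P f < ∞ := fun f =>
    (hTV f).trans_lt (ENNReal.mul_lt_top ENNReal.coe_lt_top f.2.1)
  have key : ∀ A : Set (RSpace n), MeasurableSet A → A ⊆ closure Ω → volume (closure Ω \ A) = 0 →
      (∀ (f : bvSpace Ω) (E : Set (RSpace n)), E ⊆ A → IsCaccioppoli E → IsCharFun f E →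
        s₀ ≤ regRatio T G P lam f) → ∀ f : bvSpace Ω, s₀ ≤ regRatio T G P lam f := by
    intro A hA hAΩ hAae htest f
    rw [le_regRatio_iff (hfin f).ne]
    -- Absorbing `s₀` into the seminorm avoids dividing by it and leaves `λ` as the constant `K`.
    refine seminorm_le_totalVar (N := fun f => s₀ * noiseSD T G P f) (C := s₀ * C) (K := lam)
      (fun f g => ?_) (fun c f => ?_) (fun f => ?_) (fun f => ?_) hΩb hA hAΩ hAae
      (fun f E hE hc hf => ?_) f
    · rw [← mul_add]
      gcongr
      exact noiseSD_add_le hG hfin f g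
    · rw [noiseSD_smul, mul_left_comm]
    · rw [ENNReal.coe_mul, mul_assoc]
      gcongr
      exact hTV f
    · rw [ENNReal.coe_mul, mul_assoc]
      gcongr
      exact hLinfty f
    · exact (le_regRatio_iff (hfin f).ne).1 (htest f E hE hc hf)
  -- For `A = Ω` the exceptional set `closure Ω \ Ω` is the frontier, hence null by assumption; for
  -- `A = closure Ω` it is empty.
  refine ⟨fun hfr => key Ω hΩo.measurableSet subset_closure ?_,
    key (closure Ω) isClosed_closure.measurableSet subset_rfl (by simp)⟩
  rwa [← hΩo.frontier_eq]
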